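/- Let $k\ge 1$ be an integer. On one probability space let $P_1\subseteq P_2\subseteq\cdots$ (almost surely) be point processes such that, for each $n\ge 1$, $P_n$ is a homogeneous Poisson point process in $\mathbb{R}^2$ of intensity $n$. For $r>0$ let $V_k(n,r)$ be the $k$-vacancy in the unit square, i.e. the area of the set of points of $[0,1]^2$ that lie in at most $k-1$ of the closed discs of radius $r$ centred at the points of $P_n$, and define the critical radius for complete $k$-coverage $$r_n^*:=\inf\{r>0:\ V_k(n,r)=0\}.$$ Then, almost surely, $$\lim_{n\to\infty}\frac{\pi n\,(r_n^*)^2}{\log n+k\log\log n}=1 .$$ -/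

import Mathlib

open MeasureTheory ProbabilityTheory Filter Topology
open scoped NNReal ENNReal

namespace Coverage

/-- The number of points of the configuration `S` in the set `A`. -/
noncomputable def count {d : ℕ} (S A : Set (EuclideanSpace ℝ (Fin d))) : ℕ∞ :=
  (S ∩ A).encard

/-- `P` is a stationary (homogeneous) Poisson point process in `ℝ^d` of intensity `lam`, regarded
as a random set of points: the number of points in a Borel set is a random variable, it is Poisson
with mean `lam * |A|` when the Lebesgue measure `|A|` is finite, and the numbers of points in
pairwise disjoint Borel sets are independent. -/
structure IsPoissonProcess {Ω : Type*} [MeasurableSpace Ω] {d : ℕ} (lam : ℝ≥0)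
    (P : Ω → Set (EuclideanSpace ℝ (Fin d))) (μ : Measure Ω) : Prop where
  measurable_count : ∀ A : Set (EuclideanSpace ℝ (Fin d)), MeasurableSet A →
    Measurable (fun ω => count (P ω) A)
  hasLaw_count : ∀ A : Set (EuclideanSpace ℝ (Fin d)), MeasurableSet A → volume A ≠ ∞ →
    HasLaw (fun ω => count (P ω) A)
      ((poissonMeasure (lam * (volume A).toNNReal)).map (fun m : ℕ => (m : ℕ∞))) μ
  indep_count : ∀ (m : ℕ) (A : Fin m → Set (EuclideanSpace ℝ (Fin d))),
    (∀ i, MeasurableSet (A i)) → Pairwise (fun i j => Disjoint (A i) (A j)) →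
    iIndepFun (fun i ω => count (P ω) (A i)) μ

/-- The number of points `p` of the configuration `S` whose sensing area, the closed disc of
radius `r` centred at `p`, contains `x`. -/
noncomputable def coverCount {d : ℕ} (S : Set (EuclideanSpace ℝ (Fin d))) (r : ℝ)
    (x : EuclideanSpace ℝ (Fin d)) : ℕ∞ :=
  {p ∈ S | x ∈ Metric.closedBall p r}.encard

/-- The `k`-vacancy within `R`: the volume of the part of `R` covered by at most `k - 1` of the
sensing areas. -/
noncomputable def vacancy {d : ℕ} (k : ℕ) (S : Set (EuclideanSpace ℝ (Fin d))) (r : ℝ)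
    (R : Set (EuclideanSpace ℝ (Fin d))) : ℝ≥0∞ :=
  volume {x ∈ R | coverCount S r x < k}

/-- The unit square `[0,1]²`. -/
def unitSquare : Set (EuclideanSpace ℝ (Fin 2)) := {x | ∀ i, x i ∈ Set.Icc (0 : ℝ) 1}

/-- The critical radius for complete `k`-coverage of the unit square by the configuration `S`. -/
noncomputable def criticalRadius (k : ℕ) (S : Set (EuclideanSpace ℝ (Fin 2))) : ℝ :=
  sInf {r : ℝ | 0 < r ∧ vacancy k S r unitSquare = 0}

end Coverage

/-! Since `log log n = o(log n)`, the term `k log log n` is invisible to first order, and it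
suffices that `π n r² / log n → 1` for the critical radius `r`; `k` affects only constants.

Lower bound (`ae_eventually_vacancy_ne_zero`): at level `a' < 1`, about `n ^ b` disjoint discs with
`a' < b < 1` fit in the square. Each is empty with probability `n ^ (-a')`, independently, so none
is empty with probability at most `exp (-n ^ (b - a'))`, which is summable. An empty disc slightly
larger than the sensing radius leaves positive vacancy.

Upper bound (`exists_measure_vacancy_ne_zero_le`): at level `a > 1`, take `O(n)` grid centres with
mesh a small fraction of the radius. A union bound with the Poisson lower tail gives failure
probability `O(n ^ (-c))`. As `c` may be small, Borel–Cantelli is applied along `n = j ^ m` with `m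
c > 1`. The nesting of the processes fills the gaps, because `((j + 1) / j) ^ m → 1`. -/

namespace Coverage

/-! ### Monotonicity of the vacancy and discretisation of the square. -/

section Deterministic

lemma coverCount_eq_count {d : ℕ} (S : Set (EuclideanSpace ℝ (Fin d))) (r : ℝ)
    (x : EuclideanSpace ℝ (Fin d)) :
    coverCount S r x = count S (Metric.closedBall x r) := by
  unfold coverCount count
  congr 1
  ext p
  simp [Metric.mem_closedBall, dist_comm]

lemma count_mono {d : ℕ} {S T A B : Set (EuclideanSpace ℝ (Fin d))} (hST : S ⊆ T) (hAB : A ⊆ B) :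
    count S A ≤ count T B :=
  Set.encard_le_encard (Set.inter_subset_inter hST hAB)

lemma coverCount_mono {d : ℕ} {S T : Set (EuclideanSpace ℝ (Fin d))} (hST : S ⊆ T) {r s : ℝ}
    (hrs : r ≤ s) (x : EuclideanSpace ℝ (Fin d)) : coverCount S r x ≤ coverCount T s x := by
  rw [coverCount_eq_count, coverCount_eq_count]
  exact count_mono hST (Metric.closedBall_subset_closedBall hrs)

lemma vacancy_anti {d : ℕ} (k : ℕ) {S T : Set (EuclideanSpace ℝ (Fin d))} (hST : S ⊆ T) {r s : ℝ}
    (hrs : r ≤ s) (R : Set (EuclideanSpace ℝ (Fin d))) : vacancy k T s R ≤ vacancy k S r R :=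
  measure_mono fun x hx => ⟨hx.1, (coverCount_mono hST hrs x).trans_lt hx.2⟩

lemma criticalRadius_nonneg (k : ℕ) (S : Set (EuclideanSpace ℝ (Fin 2))) :
    0 ≤ criticalRadius k S :=
  Real.sInf_nonneg fun _ hr => hr.1.le

lemma criticalRadius_le {k : ℕ} {S : Set (EuclideanSpace ℝ (Fin 2))} {r : ℝ} (hr : 0 < r)
    (h : vacancy k S r unitSquare = 0) : criticalRadius k S ≤ r :=
  csInf_le ⟨0, fun _ hs => hs.1.le⟩ ⟨hr, h⟩

/-- The witness `s` is essential: without an admissible radius the real infimum would default to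
`0`. -/
lemma le_criticalRadius {k : ℕ} {S : Set (EuclideanSpace ℝ (Fin 2))} {r s : ℝ} (hs : 0 < s)
    (h : vacancy k S s unitSquare = 0) (hr : vacancy k S r unitSquare ≠ 0) :
    r ≤ criticalRadius k S := by
  refine le_csInf ⟨s, hs, h⟩ fun t ht => ?_
  by_contra! htr
  exact hr (le_antisymm ((vacancy_anti k subset_rfl htr.le _).trans ht.2.le) bot_le)

/-- The centres of the cells of the subdivision of the unit square into `N ^ 2` squares. -/
noncomputable def cellCentre (N : ℕ) (p : Fin N × Fin N) : EuclideanSpace ℝ (Fin 2) :=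
  !₂[((p.1 : ℝ) + 1 / 2) / N, ((p.2 : ℝ) + 1 / 2) / N]

lemma exists_abs_sub_le_inv {N : ℕ} (hN : 0 < N) {t : ℝ} (ht : t ∈ Set.Icc (0 : ℝ) 1) :
    ∃ i : Fin N, |t - ((i : ℝ) + 1 / 2) / N| ≤ 1 / N := by
  have hN' : (0 : ℝ) < N := by exact_mod_cast hN
  suffices h : ∃ i : Fin N, |N * t - ((i : ℝ) + 1 / 2)| ≤ 1 by
    obtain ⟨i, hi⟩ := h
    refine ⟨i, ?_⟩
    have : t - ((i : ℝ) + 1 / 2) / N = (N * t - ((i : ℝ) + 1 / 2)) / N := by field_simp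
    rw [this, abs_div, abs_of_pos hN']
    gcongr
  -- At `t = 1` the floor of `N * t` is `N`, outside `Fin N`, so the last cell is used.
  by_cases h1 : t = 1
  · refine ⟨⟨N - 1, by omega⟩, ?_⟩
    have : ((N - 1 : ℕ) : ℝ) = N - 1 := by rw [Nat.cast_sub hN]; simp
    simp only [h1, this, abs_le]
    constructor <;> linarith
  · have hlt : t < 1 := lt_of_le_of_ne ht.2 h1
    have h0 : 0 ≤ N * t := mul_nonneg hN'.le ht.1
    refine ⟨⟨⌊N * t⌋₊, (Nat.floor_lt h0).2 (by nlinarith)⟩, ?_⟩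
    have h2 := Nat.floor_le h0
    have h3 := Nat.lt_floor_add_one (N * t)
    simp only [abs_le]
    constructor <;> linarith

lemma exists_dist_cellCentre_le {N : ℕ} (hN : 0 < N) {x : EuclideanSpace ℝ (Fin 2)}
    (hx : x ∈ unitSquare) : ∃ p, dist x (cellCentre N p) ≤ 2 / N := by
  obtain ⟨i, hi⟩ := exists_abs_sub_le_inv hN (hx 0)
  obtain ⟨j, hj⟩ := exists_abs_sub_le_inv hN (hx 1)
  refine ⟨(i, j), ?_⟩
  have hN' : (0 : ℝ) < N := by exact_mod_cast hN
  rw [EuclideanSpace.dist_eq, Fin.sum_univ_two]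
  simp only [cellCentre, Real.dist_eq]
  refine Real.sqrt_le_iff.2 ⟨by positivity, ?_⟩
  have h1 : (0 : ℝ) < 1 / N := by positivity
  have h2 : (2 : ℝ) / N = 2 * (1 / N) := by ring
  rw [h2]
  simp only [Matrix.cons_val_zero, Matrix.cons_val_one] at *
  have := pow_le_pow_left₀ (abs_nonneg _) hi 2
  have := pow_le_pow_left₀ (abs_nonneg _) hj 2
  nlinarith

lemma cellCentre_mem_Ioo {N : ℕ} (p : Fin N × Fin N) (i : Fin 2) :
    cellCentre N p i ∈ Set.Ioo (0 : ℝ) 1 := by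
  have key : ∀ j : Fin N, ((j : ℝ) + 1 / 2) / N ∈ Set.Ioo (0 : ℝ) 1 := by
    intro j
    have hj : (j : ℝ) + 1 ≤ N := by exact_mod_cast j.2
    have hj0 : (0 : ℝ) ≤ j := by positivity
    have hN : (0 : ℝ) < N := by linarith
    exact ⟨by positivity, by rw [div_lt_one hN]; linarith⟩
  fin_cases i
  · exact key p.1
  · exact key p.2

/-- Distinct cells differ by a nonzero integer in some index. Hence discs of radius below `1 / (2
N)` about the centres are disjoint. -/
lemma inv_le_dist_cellCentre {N : ℕ} {p q : Fin N × Fin N} (hpq : p ≠ q) :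
    1 / (N : ℝ) ≤ dist (cellCentre N p) (cellCentre N q) := by
  have key : ∀ i j : Fin N, i ≠ j →
      1 / (N : ℝ) ≤ |((i : ℝ) + 1 / 2) / N - ((j : ℝ) + 1 / 2) / N| := by
    intro i j hij
    have hN : (0 : ℝ) < N := by exact_mod_cast i.pos
    have h1 : ((i : ℝ) + 1 / 2) / N - ((j : ℝ) + 1 / 2) / N = ((i : ℝ) - j) / N := by ring
    rw [h1, abs_div, abs_of_pos hN]
    gcongr
    have h2 : ((i : ℕ) : ℤ) - (j : ℕ) ≠ 0 := by
      intro h; apply hij; ext; omega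
    exact_mod_cast Int.one_le_abs h2
  have hle : ∀ i : Fin 2, |cellCentre N p i - cellCentre N q i| ≤
      dist (cellCentre N p) (cellCentre N q) := fun i => by
    rw [dist_eq_norm]
    exact PiLp.norm_apply_le (cellCentre N p - cellCentre N q) i
  by_cases h : p.1 = q.1
  · exact (key p.2 q.2 fun h' => hpq (Prod.ext h h')).trans (hle 1)
  · exact (key p.1 q.1 h).trans (hle 0)

lemma isOpen_setOf_mem_Ioo :
    IsOpen {x : EuclideanSpace ℝ (Fin 2) | ∀ i, x i ∈ Set.Ioo (0 : ℝ) 1} := by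
  simp only [Set.ofPred_forall]
  exact isOpen_iInter_of_finite fun i => isOpen_Ioo.preimage (by fun_prop)

/-- If some disc of radius `s > r` centred in the interior of the square contains no point, then
the vacancy at radius `r` is positive. -/
lemma vacancy_ne_zero {k : ℕ} (hk : 1 ≤ k) {S : Set (EuclideanSpace ℝ (Fin 2))} {r s : ℝ}
    (hrs : r < s) {x : EuclideanSpace ℝ (Fin 2)} (hx : ∀ i, x i ∈ Set.Ioo (0 : ℝ) 1)
    (h : count S (Metric.closedBall x s) = 0) : vacancy k S r unitSquare ≠ 0 := by
  set U : Set (EuclideanSpace ℝ (Fin 2)) :=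
    Metric.ball x (s - r) ∩ {x | ∀ i, x i ∈ Set.Ioo (0 : ℝ) 1} with hU
  have hUo : IsOpen U := Metric.isOpen_ball.inter isOpen_setOf_mem_Ioo
  have hUpos : 0 < volume U :=
    hUo.measure_pos volume ⟨x, Metric.mem_ball_self (sub_pos.2 hrs), hx⟩
  have hsub : U ⊆ {y ∈ unitSquare | coverCount S r y < k} := by
    refine fun y hy => ⟨fun i => Set.Ioo_subset_Icc_self (hy.2 i), ?_⟩
    have h0 : coverCount S r y ≤ 0 := by
      rw [coverCount_eq_count, ← h]
      refine count_mono subset_rfl (Metric.closedBall_subset_closedBall' ?_)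
      have := Metric.mem_ball.1 hy.1
      linarith
    refine h0.trans_lt ?_
    exact_mod_cast hk
  exact (hUpos.trans_le (measure_mono hsub)).ne'

/-- If every disc of radius `r - 2 / N` around a cell centre contains at least `k` points, then the
square is completely `k`-covered at radius `r`. -/
lemma vacancy_eq_zero {k N : ℕ} (hN : 0 < N) {S : Set (EuclideanSpace ℝ (Fin 2))} {r s : ℝ}
    (hrs : s + 2 / N ≤ r) (h : ∀ p, ¬ count S (Metric.closedBall (cellCentre N p) s) < k) :
    vacancy k S r unitSquare = 0 := by
  have : {x ∈ unitSquare | coverCount S r x < k} = ∅ := by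
    refine Set.eq_empty_iff_forall_notMem.2 fun x hx => ?_
    obtain ⟨p, hp⟩ := exists_dist_cellCentre_le hN hx.1
    refine h p (lt_of_le_of_lt ?_ hx.2)
    rw [coverCount_eq_count]
    refine count_mono subset_rfl (Metric.closedBall_subset_closedBall' ?_)
    rw [dist_comm]
    linarith
  rw [vacancy, this, measure_empty]

end Deterministic

/-! ### Poisson estimates at a fixed intensity. -/

section Probability

/-- A Chernoff-type bound: for `i < k` one has `t ^ i ≤ s ^ (-k) * (s * t) ^ i`, and the resulting
partial sum is at most `exp (s * t)`. The tail thus loses only a factor `1 - s` in the exponent and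
a constant depending on `k`. -/
lemma poissonMeasure_Iio_le (t : ℝ≥0) (k : ℕ) {s : ℝ} (hs : 0 < s) (hs1 : s ≤ 1) :
    poissonMeasure t (Set.Iio k) ≤ ENNReal.ofReal ((s ^ k)⁻¹ * Real.exp (-((1 - s) * t))) := by
  have h1 : Set.Iio k = ⋃ i ∈ Finset.range k, ({i} : Set ℕ) := by ext; simp
  rw [h1]
  refine (measure_biUnion_finset_le _ _).trans ?_
  simp only [poissonMeasure_singleton]
  rw [← ENNReal.ofReal_sum_of_nonneg (fun i _ => by positivity)]
  refine ENNReal.ofReal_le_ofReal ?_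
  have h2 : Real.exp (-((1 - s) * t)) = Real.exp (-t) * Real.exp (s * t) := by
    rw [← Real.exp_add]; ring_nf
  rw [h2]
  calc ∑ i ∈ Finset.range k, Real.exp (-(t : ℝ)) * (t : ℝ) ^ i / (i.factorial : ℝ)
      ≤ ∑ i ∈ Finset.range k,
          (s ^ k)⁻¹ * Real.exp (-(t : ℝ)) * ((s * t) ^ i / (i.factorial : ℝ)) := by
        refine Finset.sum_le_sum fun i hi => ?_
        have hi' : s ^ k ≤ s ^ i := pow_le_pow_of_le_one hs.le hs1 (Finset.mem_range.1 hi).le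
        have h3 : 1 ≤ (s ^ k)⁻¹ * s ^ i := by
          rw [inv_mul_eq_div, one_le_div (by positivity)]; exact hi'
        have h4 : (s ^ k)⁻¹ * Real.exp (-(t : ℝ)) * ((s * t) ^ i / (i.factorial : ℝ)) =
          ((s ^ k)⁻¹ * s ^ i) * (Real.exp (-(t : ℝ)) * (t : ℝ) ^ i / (i.factorial : ℝ)) := by
          rw [mul_pow]; ring
        rw [h4]
        exact le_mul_of_one_le_left (by positivity) h3
    _ = (s ^ k)⁻¹ * Real.exp (-(t : ℝ)) *
          ∑ i ∈ Finset.range k, (s * t) ^ i / (i.factorial : ℝ) := by rw [Finset.mul_sum]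
    _ ≤ (s ^ k)⁻¹ * Real.exp (-(t : ℝ)) * Real.exp (s * t) := by
        gcongr
        exact Real.sum_le_exp_of_nonneg (by positivity) k
    _ = _ := by ring

variable {Ω : Type*} [MeasurableSpace Ω] {μ : Measure Ω} {lam : ℝ≥0}
  {P : Ω → Set (EuclideanSpace ℝ (Fin 2))}

lemma volume_closedBall_toNNReal (x : EuclideanSpace ℝ (Fin 2)) {r : ℝ} (hr : 0 ≤ r) :
    ((volume (Metric.closedBall x r)).toNNReal : ℝ) = Real.pi * r ^ 2 := by
  rw [EuclideanSpace.volume_closedBall_fin_two, ENNReal.coe_toNNReal_eq_toReal]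
  simp [hr, Real.pi_pos.le, mul_comm]

lemma IsPoissonProcess.measure_count_preimage (hP : IsPoissonProcess lam P μ)
    (x : EuclideanSpace ℝ (Fin 2)) (r : ℝ) (s : Set ℕ∞) :
    μ ((fun ω => count (P ω) (Metric.closedBall x r)) ⁻¹' s) =
      poissonMeasure (lam * (volume (Metric.closedBall x r)).toNNReal)
        ((fun m : ℕ => (m : ℕ∞)) ⁻¹' s) := by
  have hm := hP.measurable_count (Metric.closedBall x r) Metric.isClosed_closedBall.measurableSet
  have hl := hP.hasLaw_count (Metric.closedBall x r) Metric.isClosed_closedBall.measurableSet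
    measure_closedBall_lt_top.ne
  rw [← Measure.map_apply hm (MeasurableSet.of_discrete), hl.map_eq,
    Measure.map_apply (measurable_of_countable _) (MeasurableSet.of_discrete)]

lemma IsPoissonProcess.measure_count_lt_le (hP : IsPoissonProcess lam P μ)
    (x : EuclideanSpace ℝ (Fin 2)) {r : ℝ} (hr : 0 ≤ r) (k : ℕ) {s : ℝ} (hs : 0 < s)
    (hs1 : s ≤ 1) :
    μ {ω | count (P ω) (Metric.closedBall x r) < k} ≤
      ENNReal.ofReal ((s ^ k)⁻¹ * Real.exp (-((1 - s) * (lam * (Real.pi * r ^ 2))))) := by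
  have h1 : {ω | count (P ω) (Metric.closedBall x r) < k} =
    (fun ω => count (P ω) (Metric.closedBall x r)) ⁻¹' Set.Iio (k : ℕ∞) := rfl
  have h2 : (fun m : ℕ => (m : ℕ∞)) ⁻¹' Set.Iio (k : ℕ∞) = Set.Iio k := by ext; simp
  rw [h1, hP.measure_count_preimage, h2]
  refine (poissonMeasure_Iio_le _ k hs hs1).trans_eq ?_
  rw [NNReal.coe_mul, volume_closedBall_toNNReal x hr]

lemma IsPoissonProcess.measure_count_eq_zero (hP : IsPoissonProcess lam P μ)
    (x : EuclideanSpace ℝ (Fin 2)) {r : ℝ} (hr : 0 ≤ r) :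
    μ ((fun ω => count (P ω) (Metric.closedBall x r)) ⁻¹' {0}) =
      ENNReal.ofReal (Real.exp (-(lam * (Real.pi * r ^ 2)))) := by
  have h2 : (fun m : ℕ => (m : ℕ∞)) ⁻¹' {0} = {0} := by ext; simp
  rw [hP.measure_count_preimage, h2, poissonMeasure_singleton, NNReal.coe_mul,
    volume_closedBall_toNNReal x hr]
  simp

/-- Complete coverage is unlikely when the discs are too small: the expected number of empty discs
among `N ^ 2` disjoint ones enters the exponent. -/
lemma IsPoissonProcess.measure_vacancy_eq_zero_le [IsProbabilityMeasure μ]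
    (hP : IsPoissonProcess lam P μ) {k : ℕ} (hk : 1 ≤ k) {N : ℕ} {r s : ℝ} (hrs : r < s)
    (hs : 0 ≤ s) (hN : 2 * s < 1 / N) :
    μ {ω | vacancy k (P ω) r unitSquare = 0} ≤
      ENNReal.ofReal (Real.exp (-((N : ℝ) ^ 2 * Real.exp (-(lam * (Real.pi * s ^ 2)))))) := by
  let A : Fin (N * N) → Set (EuclideanSpace ℝ (Fin 2)) := fun i =>
    Metric.closedBall (cellCentre N (finProdFinEquiv.symm i)) s
  have hA : ∀ i, MeasurableSet (A i) := fun i => Metric.isClosed_closedBall.measurableSet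
  have hdisj : Pairwise fun i j => Disjoint (A i) (A j) := fun i j hij =>
    Metric.closedBall_disjoint_closedBall (by
      have := inv_le_dist_cellCentre (finProdFinEquiv.symm.injective.ne hij)
      linarith)
  have hind := hP.indep_count (N * N) A hA hdisj
  have hsub : {ω | vacancy k (P ω) r unitSquare = 0} ⊆
      ⋂ i ∈ Finset.univ, (fun ω => count (P ω) (A i)) ⁻¹' {0}ᶜ := by
    intro ω hω
    simp only [Set.mem_iInter, Set.mem_preimage, Set.mem_compl_iff, Set.mem_singleton_iff]
    intro i _ h0
    exact vacancy_ne_zero hk hrs (cellCentre_mem_Ioo _) h0 hω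
  refine (measure_mono hsub).trans ?_
  rw [hind.measure_inter_preimage_eq_mul Finset.univ (sets := fun _ => {0}ᶜ)
    (fun _ _ => MeasurableSet.of_discrete)]
  set q := Real.exp (-(lam * (Real.pi * s ^ 2))) with hq
  have hq1 : q ≤ 1 := Real.exp_le_one_iff.2 (neg_nonpos.2 (by positivity))
  have hone : ∀ i, μ ((fun ω => count (P ω) (A i)) ⁻¹' {0}ᶜ) ≤ ENNReal.ofReal (Real.exp (-q)) := by
    intro i
    rw [Set.preimage_compl, prob_compl_eq_one_sub
      (hP.measurable_count _ (hA i) (MeasurableSet.of_discrete)),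
      hP.measure_count_eq_zero _ hs, ← ENNReal.ofReal_one, ← ENNReal.ofReal_sub _ (by positivity)]
    exact ENNReal.ofReal_le_ofReal (by linarith [Real.add_one_le_exp (-q)])
  refine (Finset.prod_le_prod' fun i _ => hone i).trans_eq ?_
  rw [Finset.prod_const, Finset.card_univ, Fintype.card_fin, ← ENNReal.ofReal_pow (by positivity),
    ← Real.exp_nat_mul]
  congr 2
  push_cast
  ring

/-- A union bound over the cell centres for the failure of complete `k`-coverage. -/
lemma IsPoissonProcess.measure_vacancy_ne_zero_le (hP : IsPoissonProcess lam P μ) (k : ℕ)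
    {N : ℕ} (hN : 0 < N) {r s t : ℝ} (hs : 0 ≤ s) (hrs : s + 2 / N ≤ r) (ht : 0 < t)
    (ht1 : t ≤ 1) :
    μ {ω | vacancy k (P ω) r unitSquare ≠ 0} ≤ ENNReal.ofReal
      ((N : ℝ) ^ 2 * ((t ^ k)⁻¹ * Real.exp (-((1 - t) * (lam * (Real.pi * s ^ 2)))))) := by
  have hsub : {ω | vacancy k (P ω) r unitSquare ≠ 0} ⊆
      ⋃ p ∈ (Finset.univ : Finset (Fin N × Fin N)),
        {ω | count (P ω) (Metric.closedBall (cellCentre N p) s) < k} := by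
    intro ω hω
    by_contra h
    simp only [Set.mem_iUnion, not_exists] at h
    exact hω (vacancy_eq_zero hN hrs fun p => h p (Finset.mem_univ p))
  refine (measure_mono hsub).trans ((measure_biUnion_finset_le _ _).trans ?_)
  refine (Finset.sum_le_sum fun p _ => hP.measure_count_lt_le _ hs k ht ht1).trans_eq ?_
  rw [Finset.sum_const, Finset.card_univ, Fintype.card_prod, Fintype.card_fin, nsmul_eq_mul,
    ← ENNReal.ofReal_natCast, ← ENNReal.ofReal_mul (by positivity)]
  congr 1
  push_cast
  ring

end Probability

/-! ### Borel–Cantelli and the radii on the scale `log n / n`. -/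

lemma ae_eventually_notMem_of_le_ofReal {Ω : Type*} [MeasurableSpace Ω] {μ : Measure Ω}
    {s : ℕ → Set Ω} {f : ℕ → ℝ} (hf : Summable f)
    (h : ∀ᶠ n in atTop, μ (s n) ≤ ENNReal.ofReal (f n)) :
    ∀ᵐ ω ∂μ, ∀ᶠ n in atTop, ω ∉ s n := by
  classical
  -- Events violating the bound, finitely many, are replaced by `∅` so that the whole series
  -- converges.
  let s' : ℕ → Set Ω := fun n => if μ (s n) ≤ ENNReal.ofReal (f n) then s n else ∅
  have hs' : ∑' n, μ (s' n) ≠ ∞ := by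
    refine ne_top_of_le_ne_top hf.tsum_ofReal_ne_top (ENNReal.tsum_le_tsum fun n => ?_)
    simp only [s']
    split_ifs with hn
    · exact hn
    · simp
  filter_upwards [ae_eventually_notMem hs'] with ω hω
  filter_upwards [hω, h] with n hn hn'
  simpa [s', hn'] using hn

lemma eventually_log_le_mul_rpow {c e : ℝ} (hc : 0 < c) (he : 0 < e) :
    ∀ᶠ n : ℕ in atTop, Real.log n ≤ c * (n : ℝ) ^ e := by
  have h := (isLittleO_log_rpow_atTop he).bound hc
  filter_upwards [tendsto_natCast_atTop_atTop.eventually h, eventually_ge_atTop 1] with n hn h1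
  have h0 : (0 : ℝ) ≤ (n : ℝ) ^ e := by positivity
  rw [Real.norm_eq_abs, Real.norm_eq_abs, abs_of_nonneg h0] at hn
  exact (le_abs_self _).trans hn

/-- The radius `r` with `π n r ^ 2 = a log n`. -/
noncomputable def logRadius (a : ℝ) (n : ℕ) : ℝ := √(a * Real.log n / (Real.pi * n))

lemma logRadius_nonneg (a : ℝ) (n : ℕ) : 0 ≤ logRadius a n := Real.sqrt_nonneg _

lemma logRadius_pos {a : ℝ} (ha : 0 < a) {n : ℕ} (hn : 2 ≤ n) : 0 < logRadius a n := by
  have h1 : 0 < Real.log n := Real.log_pos (by exact_mod_cast hn)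
  have h2 : (0 : ℝ) < n := by positivity
  have := Real.pi_pos
  exact Real.sqrt_pos.2 (by positivity)

lemma logRadius_sq {a : ℝ} (ha : 0 ≤ a) (n : ℕ) :
    logRadius a n ^ 2 = a * Real.log n / (Real.pi * n) :=
  Real.sq_sqrt (by have := Real.pi_pos; have := Real.log_natCast_nonneg n; positivity)

lemma mul_logRadius_sq {a : ℝ} (ha : 0 ≤ a) {n : ℕ} (hn : 0 < n) :
    (n : ℝ) * (Real.pi * logRadius a n ^ 2) = a * Real.log n := by
  have h2 : (0 : ℝ) < n := by exact_mod_cast hn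
  have := Real.pi_pos
  rw [logRadius_sq ha]
  field_simp

lemma logRadius_lt {a b : ℝ} (ha : 0 ≤ a) (hab : a < b) {n : ℕ} (hn : 2 ≤ n) :
    logRadius a n < logRadius b n := by
  have h1 : 0 < Real.log n := Real.log_pos (by exact_mod_cast hn)
  have h2 : (0 : ℝ) < n := by positivity
  have := Real.pi_pos
  exact Real.sqrt_lt_sqrt (by positivity) (by gcongr)

/-! ### Lower bound: independent empty discs. -/

section Lower

variable {Ω : Type*} [MeasurableSpace Ω] {μ : Measure Ω} [IsProbabilityMeasure μ]
  {P : ℕ → Ω → Set (EuclideanSpace ℝ (Fin 2))}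

/-- With about `n ^ b` cells, squared radius over squared cell side is of order `n ^ (b - 1) * log
n`, which tends to `0`. -/
lemma eventually_two_mul_logRadius_lt {a b : ℝ} (ha : 0 ≤ a) (ha1 : a ≤ 1) (hb0 : 0 < b)
    (hb : b < 1) :
    ∀ᶠ n : ℕ in atTop, 2 * logRadius a n < 1 / (⌈(n : ℝ) ^ (b / 2)⌉₊ : ℝ) := by
  -- The ceiling is at most `2 * x`, so the square to bound is `16 * x ^ 2 * a * log n / (π * n)`;
  -- the constant `1 / 32` makes its numerator at most `n / 2`.
  filter_upwards [eventually_log_le_mul_rpow (show (0 : ℝ) < 1 / 32 by norm_num)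
    (sub_pos.2 hb), eventually_ge_atTop 2] with n hn h2
  have hn0 : (0 : ℝ) < n := by positivity
  have hn1 : (1 : ℝ) ≤ n := by exact_mod_cast (by omega : 1 ≤ n)
  set x := (n : ℝ) ^ (b / 2) with hx
  have hx1 : 1 ≤ x := Real.one_le_rpow hn1 (by positivity)
  have hxx : x ^ 2 * (n : ℝ) ^ (1 - b) = n := by
    rw [hx, ← Real.rpow_natCast, ← Real.rpow_mul hn0.le, ← Real.rpow_add hn0]
    conv_rhs => rw [← Real.rpow_one (n : ℝ)]
    congr 1
    push_cast
    ring
  have hN : (⌈x⌉₊ : ℝ) ≤ 2 * x := by linarith [Nat.ceil_lt_add_one (by positivity : 0 ≤ x)]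
  have hNpos : (0 : ℝ) < ⌈x⌉₊ := by exact_mod_cast Nat.ceil_pos.2 (by positivity)
  have hL : 0 ≤ logRadius a n := logRadius_nonneg _ _
  rw [lt_div_iff₀ hNpos]
  refine (mul_le_mul_of_nonneg_left hN (by positivity)).trans_lt ?_
  refine lt_of_pow_lt_pow_left₀ 2 zero_le_one ?_
  have hsq : (2 * logRadius a n * (2 * x)) ^ 2 = 16 * x ^ 2 * logRadius a n ^ 2 := by ring
  have hlog : 0 < Real.log n := Real.log_pos (by exact_mod_cast h2)
  have hpi := Real.pi_gt_three
  rw [hsq, logRadius_sq ha, one_pow, ← mul_div_assoc, div_lt_one (by positivity)]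
  have h3 : 16 * x ^ 2 * (a * Real.log n) ≤ 16 * x ^ 2 * (1 * (1 / 32 * (n : ℝ) ^ (1 - b))) := by
    gcongr
  have h4 : 16 * x ^ 2 * (1 * (1 / 32 * (n : ℝ) ^ (1 - b))) = n / 2 := by linear_combination hxx / 2
  nlinarith

/-- Below the threshold, the square is eventually not completely covered. -/
theorem ae_eventually_vacancy_ne_zero {k : ℕ} (hk : 1 ≤ k)
    (hP : ∀ n : ℕ, 1 ≤ n → IsPoissonProcess (n : ℝ≥0) (P n) μ) {a : ℝ} (ha0 : 0 < a)
    (ha1 : a < 1) :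
    ∀ᵐ ω ∂μ, ∀ᶠ n in atTop, vacancy k (P n ω) (logRadius a n) unitSquare ≠ 0 := by
  -- `a'` gives the empty discs a radius strictly above the sensing radius; `b` sets their number.
  -- Then `log n ≤ n ^ (b - a') / 2` turns the bound `exp (-n ^ (b - a'))` into `n ^ (-2)`.
  obtain ⟨a', haa', ha'1⟩ := exists_between ha1
  obtain ⟨b, ha'b, hb1⟩ := exists_between ha'1
  have ha'0 : 0 < a' := ha0.trans haa'
  refine ae_eventually_notMem_of_le_ofReal (f := fun n => (n : ℝ) ^ (-2 : ℝ))
    (s := fun n => {ω | vacancy k (P n ω) (logRadius a n) unitSquare = 0})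
    (Real.summable_nat_rpow.2 (by norm_num)) ?_
  filter_upwards [eventually_two_mul_logRadius_lt ha'0.le ha'1.le (ha'0.trans ha'b) hb1,
    eventually_log_le_mul_rpow (show (0 : ℝ) < 1 / 2 by norm_num) (sub_pos.2 ha'b),
    eventually_ge_atTop 2] with n hN hlog h2
  have hn0 : (0 : ℝ) < n := by positivity
  refine ((hP n (by omega)).measure_vacancy_eq_zero_le hk (logRadius_lt ha0.le haa' h2)
    (logRadius_nonneg _ _) hN).trans (ENNReal.ofReal_le_ofReal ?_)
  rw [NNReal.coe_natCast, mul_logRadius_sq ha'0.le (by omega), Real.rpow_def_of_pos hn0 (-2),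
    Real.exp_le_exp]
  have h3 : Real.exp (-(a' * Real.log n)) = (n : ℝ) ^ (-a') := by
    rw [Real.rpow_def_of_pos hn0]; ring_nf
  have h4 : (n : ℝ) ^ b ≤ (⌈(n : ℝ) ^ (b / 2)⌉₊ : ℝ) ^ 2 := by
    calc (n : ℝ) ^ b = ((n : ℝ) ^ (b / 2)) ^ 2 := by
          rw [← Real.rpow_natCast, ← Real.rpow_mul hn0.le]; congr 1; push_cast; ring
      _ ≤ _ := by gcongr; exact Nat.le_ceil _
  have h5 : (n : ℝ) ^ (b - a') ≤ (⌈(n : ℝ) ^ (b / 2)⌉₊ : ℝ) ^ 2 * (n : ℝ) ^ (-a') := by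
    rw [sub_eq_add_neg, Real.rpow_add hn0]; gcongr
  rw [h3]
  linarith

end Lower

/-! ### Upper bound: union bound, subsequence of powers, interpolation. -/

section Upper

variable {Ω : Type*} [MeasurableSpace Ω] {μ : Measure Ω}
  {P : ℕ → Ω → Set (EuclideanSpace ℝ (Fin 2))}

/-- Two of the three factors `1 - t` come from shrinking the radius, which enters squared; the third
comes from the Poisson tail bound. -/
lemma exists_one_lt_mul_one_sub_pow {a : ℝ} (ha : 1 < a) :
    ∃ t : ℝ, 0 < t ∧ t < 1 ∧ 1 < a * (1 - t) ^ 3 := by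
  have hcont : Tendsto (fun t : ℝ => a * (1 - t) ^ 3) (𝓝[>] 0) (𝓝 (a * (1 - 0) ^ 3)) :=
    (Continuous.tendsto (by fun_prop) 0).mono_left nhdsWithin_le_nhds
  have h := hcont.eventually (lt_mem_nhds (show (1 : ℝ) < a * (1 - 0) ^ 3 by simpa using ha))
  obtain ⟨t, h1, h2⟩ := (h.and (Ioo_mem_nhdsGT (zero_lt_one' ℝ))).exists
  exact ⟨t, h2.1, h2.2, h1⟩

lemma exists_measure_vacancy_ne_zero_le (k : ℕ)
    (hP : ∀ n : ℕ, 1 ≤ n → IsPoissonProcess (n : ℝ≥0) (P n) μ) {a : ℝ} (ha : 1 < a) :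
    ∃ C c : ℝ, 0 < c ∧ ∀ᶠ n : ℕ in atTop,
      μ {ω | vacancy k (P n ω) (logRadius a n) unitSquare ≠ 0} ≤
        ENNReal.ofReal (C * (n : ℝ) ^ (-c)) := by
  obtain ⟨t, ht0, ht1, hb⟩ := exists_one_lt_mul_one_sub_pow ha
  refine ⟨9 / t ^ 2 * (t ^ k)⁻¹, a * (1 - t) ^ 3 - 1, sub_pos.2 hb, ?_⟩
  -- Once `log n ≥ 4 ≥ π`, the radius is at least `1 / √n`.
  have hlog := (Real.tendsto_log_atTop.comp tendsto_natCast_atTop_atTop).eventually_ge_atTop 4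
  filter_upwards [hlog, eventually_ge_atTop 2] with n hlog h2
  simp only [Function.comp_apply] at hlog
  have hn0 : (0 : ℝ) < n := by positivity
  have hn1 : (1 : ℝ) ≤ n := by exact_mod_cast (by omega : 1 ≤ n)
  have hs1 : 1 ≤ √(n : ℝ) := Real.one_le_sqrt.2 hn1
  have hs2 : √(n : ℝ) ^ 2 = n := Real.sq_sqrt hn0.le
  have hrad : 1 / √(n : ℝ) ≤ logRadius a n := by
    rw [logRadius, one_div, ← Real.sqrt_inv, ← one_div]
    refine Real.sqrt_le_sqrt ?_
    have := Real.pi_le_four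
    have := Real.pi_pos
    have h1 : Real.pi ≤ a * Real.log n := by nlinarith
    rw [div_le_div_iff₀ hn0 (by positivity), one_mul]
    gcongr
  -- Chosen so that `2 / x = t / √n`: the discretisation error is at most the fraction `t` of the
  -- radius, with only `O(n)` cells.
  set x := 2 * √(n : ℝ) / t with hx
  have hx1 : 2 * √(n : ℝ) ≤ x := by
    rw [hx, le_div_iff₀ ht0]; nlinarith
  have hx0 : 0 < x := by positivity
  have hN0 : 0 < ⌈x⌉₊ := Nat.ceil_pos.2 hx0
  have hN0' : (0 : ℝ) < ⌈x⌉₊ := by exact_mod_cast hN0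
  have hNx : (⌈x⌉₊ : ℝ) ≤ 3 * √(n : ℝ) / t := by
    have h1 := Nat.ceil_lt_add_one hx0.le
    have h3 : 3 * √(n : ℝ) / t = x + √(n : ℝ) / t := by rw [hx]; ring
    have h4 : 1 ≤ √(n : ℝ) / t := by rw [le_div_iff₀ ht0]; linarith
    linarith
  have hmesh : (1 - t) * logRadius a n + 2 / ⌈x⌉₊ ≤ logRadius a n := by
    have h1 : (2 : ℝ) / ⌈x⌉₊ ≤ 2 / x := by gcongr; exact Nat.le_ceil x
    have h3 : 2 / x = t * (1 / √(n : ℝ)) := by rw [hx]; field_simp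
    nlinarith
  refine ((hP n (by omega)).measure_vacancy_ne_zero_le k hN0
    (mul_nonneg (sub_nonneg.2 ht1.le) (logRadius_nonneg _ _)) hmesh ht0 ht1.le).trans
    (ENNReal.ofReal_le_ofReal ?_)
  have hexp : (1 - t) * (((n : ℝ≥0) : ℝ) * (Real.pi * ((1 - t) * logRadius a n) ^ 2)) =
      a * (1 - t) ^ 3 * Real.log n := by
    have := mul_logRadius_sq (by linarith : 0 ≤ a) (by omega : 0 < n)
    rw [NNReal.coe_natCast]
    linear_combination (1 - t) ^ 3 * this
  have hpow : Real.exp (-(a * (1 - t) ^ 3 * Real.log n)) =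
      (n : ℝ)⁻¹ * (n : ℝ) ^ (-(a * (1 - t) ^ 3 - 1)) := by
    rw [← Real.rpow_neg_one, ← Real.rpow_add hn0, Real.rpow_def_of_pos hn0]
    ring_nf
  rw [hexp, hpow]
  calc (⌈x⌉₊ : ℝ) ^ 2 * ((t ^ k)⁻¹ * ((n : ℝ)⁻¹ * (n : ℝ) ^ (-(a * (1 - t) ^ 3 - 1))))
      ≤ (3 * √(n : ℝ) / t) ^ 2 *
          ((t ^ k)⁻¹ * ((n : ℝ)⁻¹ * (n : ℝ) ^ (-(a * (1 - t) ^ 3 - 1)))) := by gcongr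
    _ = _ := by
        rw [div_pow, mul_pow, hs2]
        field_simp
        norm_num

/-- Above the threshold, the square is eventually completely `k`-covered along a sequence of
powers. -/
lemma exists_ae_eventually_vacancy_pow_eq_zero (k : ℕ)
    (hP : ∀ n : ℕ, 1 ≤ n → IsPoissonProcess (n : ℝ≥0) (P n) μ) {a : ℝ} (ha : 1 < a) :
    ∃ m : ℕ, m ≠ 0 ∧ ∀ᵐ ω ∂μ, ∀ᶠ j : ℕ in atTop,
      vacancy k (P (j ^ m) ω) (logRadius a (j ^ m)) unitSquare = 0 := by
  obtain ⟨C, c, hc, h⟩ := exists_measure_vacancy_ne_zero_le k hP ha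
  obtain ⟨m, hm⟩ := exists_nat_gt (1 / c)
  have hm0 : m ≠ 0 := by
    rintro rfl
    have : 0 < 1 / c := by positivity
    simp only [Nat.cast_zero] at hm
    linarith
  refine ⟨m, hm0, ?_⟩
  have hsum : Summable fun j : ℕ => C * (((j ^ m : ℕ) : ℝ)) ^ (-c) := by
    refine Summable.mul_left C ?_
    have h1 : ∀ j : ℕ, ((j ^ m : ℕ) : ℝ) ^ (-c) = (j : ℝ) ^ (-(m * c)) := fun j => by
      rw [Nat.cast_pow, ← Real.rpow_natCast, ← Real.rpow_mul (by positivity), mul_neg]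
    simp only [h1]
    refine Real.summable_nat_rpow.2 (neg_lt_neg ?_)
    rwa [div_lt_iff₀ hc] at hm
  filter_upwards [ae_eventually_notMem_of_le_ofReal hsum
    ((tendsto_pow_atTop hm0).eventually h)] with ω hω
  filter_upwards [hω] with j hj
  simpa using hj

lemma tendsto_floor_rpow_inv_atTop {m : ℕ} (hm : m ≠ 0) :
    Tendsto (fun n : ℕ => ⌊(n : ℝ) ^ ((m : ℝ)⁻¹)⌋₊) atTop atTop :=
  tendsto_nat_floor_atTop.comp
    ((tendsto_rpow_atTop (by positivity)).comp tendsto_natCast_atTop_atTop)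

lemma floor_rpow_inv_pow_le {m : ℕ} (hm : m ≠ 0) (n : ℕ) :
    ⌊(n : ℝ) ^ ((m : ℝ)⁻¹)⌋₊ ^ m ≤ n := by
  have h := pow_le_pow_left₀ (by positivity)
    (Nat.floor_le (by positivity : 0 ≤ (n : ℝ) ^ ((m : ℝ)⁻¹))) m
  rw [Real.rpow_inv_natCast_pow (by positivity) hm] at h
  exact_mod_cast h

lemma le_floor_rpow_inv_add_one_pow {m : ℕ} (hm : m ≠ 0) (n : ℕ) :
    n ≤ (⌊(n : ℝ) ^ ((m : ℝ)⁻¹)⌋₊ + 1) ^ m := by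
  have h := pow_le_pow_left₀ (by positivity)
    (Nat.lt_floor_add_one ((n : ℝ) ^ ((m : ℝ)⁻¹))).le m
  rw [Real.rpow_inv_natCast_pow (by positivity) hm] at h
  exact_mod_cast h

lemma eventually_add_one_pow_le {m : ℕ} {e : ℝ} (he : 1 < e) :
    ∀ᶠ j : ℕ in atTop, ((j : ℝ) + 1) ^ m ≤ e * (j : ℝ) ^ m := by
  have h1 : Tendsto (fun j : ℕ => (1 + 1 / (j : ℝ)) ^ m) atTop (𝓝 ((1 + 0) ^ m)) :=
    (tendsto_const_nhds.add tendsto_one_div_atTop_nhds_zero_nat).pow m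
  have h2 := h1.eventually (gt_mem_nhds (show ((1 : ℝ) + 0) ^ m < e by simpa using he))
  filter_upwards [h2, eventually_gt_atTop 0] with j hj hj0
  have hj0' : (0 : ℝ) < j := by exact_mod_cast hj0
  have h3 : ((j : ℝ) + 1) ^ m = (1 + 1 / (j : ℝ)) ^ m * (j : ℝ) ^ m := by
    rw [← mul_pow]; congr 1; field_simp
  rw [h3]
  gcongr

/-- For nested configurations, complete coverage along a sequence of powers bounds the radius of
complete coverage along the whole sequence. -/
lemma eventually_exists_vacancy_eq_zero {k m : ℕ} (hm : m ≠ 0)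
    {S : ℕ → Set (EuclideanSpace ℝ (Fin 2))} (hS : ∀ n : ℕ, 1 ≤ n → S n ⊆ S (n + 1))
    {a b : ℝ} (ha : 0 < a) (hab : a < b)
    (h : ∀ᶠ j : ℕ in atTop, vacancy k (S (j ^ m)) (logRadius a (j ^ m)) unitSquare = 0) :
    ∀ᶠ n : ℕ in atTop, ∃ r : ℝ, 0 < r ∧ vacancy k (S n) r unitSquare = 0 ∧
      Real.pi * n * r ^ 2 ≤ b * Real.log n := by
  have hmono : ∀ i j : ℕ, 1 ≤ i → i ≤ j → S i ⊆ S j := by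
    intro i j hi hij
    induction j, hij using Nat.le_induction with
    | base => exact subset_rfl
    | succ j hj ih => exact ih.trans (hS j (hi.trans hj))
  -- With `j = ⌊n ^ (1 / m)⌋`, eventually `j ^ m ≤ n ≤ (j + 1) ^ m ≤ (b / a) * j ^ m`. The radius
  -- that works at `j ^ m` works at `n` by nesting, and the ratio `b / a` is exactly the slack
  -- between the two levels.
  have hj := (tendsto_floor_rpow_inv_atTop hm).eventually
    ((h.and (eventually_add_one_pow_le (m := m) ((one_lt_div ha).2 hab))).and
      (eventually_ge_atTop 2))
  filter_upwards [hj] with n hn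
  have hle := floor_rpow_inv_pow_le hm n
  have hge := le_floor_rpow_inv_add_one_pow hm n
  generalize ⌊(n : ℝ) ^ ((m : ℝ)⁻¹)⌋₊ = j at hn hle hge
  obtain ⟨⟨hvac, hpow⟩, hj2⟩ := hn
  have hjm : 2 ≤ j ^ m := hj2.trans (Nat.le_self_pow hm j)
  refine ⟨logRadius a (j ^ m), logRadius_pos ha hjm, le_antisymm ?_ bot_le, ?_⟩
  · exact (vacancy_anti k (hmono _ _ (by omega) hle) le_rfl _).trans hvac.le
  · have hjm0 : (0 : ℝ) < ((j ^ m : ℕ) : ℝ) := by exact_mod_cast (by omega : 0 < j ^ m)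
    have hlog : Real.log ((j ^ m : ℕ) : ℝ) ≤ Real.log n :=
      Real.log_le_log hjm0 (by exact_mod_cast hle)
    have hlog0 : 0 ≤ Real.log ((j ^ m : ℕ) : ℝ) := Real.log_natCast_nonneg _
    have hn : (n : ℝ) ≤ b / a * ((j ^ m : ℕ) : ℝ) := by
      refine le_trans (b := ((j : ℝ) + 1) ^ m) (by exact_mod_cast hge) ?_
      rw [Nat.cast_pow]
      exact hpow
    have hba : 0 < b / a := div_pos (ha.trans hab) ha
    calc Real.pi * n * logRadius a (j ^ m) ^ 2
        ≤ Real.pi * (b / a * ((j ^ m : ℕ) : ℝ)) * logRadius a (j ^ m) ^ 2 := by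
          have := Real.pi_pos
          gcongr
      _ = b / a * (((j ^ m : ℕ) : ℝ) * (Real.pi * logRadius a (j ^ m) ^ 2)) := by ring
      _ = b * Real.log ((j ^ m : ℕ) : ℝ) := by
          rw [mul_logRadius_sq ha.le (by omega)]; field_simp
      _ ≤ b * Real.log n := by
          have := ha.trans hab
          gcongr

theorem ae_eventually_exists_vacancy_eq_zero (k : ℕ)
    (hP : ∀ n : ℕ, 1 ≤ n → IsPoissonProcess (n : ℝ≥0) (P n) μ)
    (hmono : ∀ᵐ ω ∂μ, ∀ n : ℕ, 1 ≤ n → P n ω ⊆ P (n + 1) ω) {b : ℝ} (hb : 1 < b) :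
    ∀ᵐ ω ∂μ, ∀ᶠ n : ℕ in atTop, ∃ r : ℝ, 0 < r ∧ vacancy k (P n ω) r unitSquare = 0 ∧
      Real.pi * n * r ^ 2 ≤ b * Real.log n := by
  obtain ⟨a, ha1, hab⟩ := exists_between hb
  obtain ⟨m, hm, h⟩ := exists_ae_eventually_vacancy_pow_eq_zero k hP ha1
  filter_upwards [h, hmono] with ω hω hmonoω
  exact eventually_exists_vacancy_eq_zero hm (S := fun n => P n ω) hmonoω
    (zero_lt_one.trans ha1) hab hω

end Upper

/-! ### Assembling the limit. -/

lemma tendsto_log_div_log_add_log_log (k : ℕ) :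
    Tendsto (fun n : ℕ => Real.log n / (Real.log n + (k : ℝ) * Real.log (Real.log n)))
      atTop (𝓝 1) := by
  have hL : Tendsto (fun n : ℕ => Real.log n) atTop atTop :=
    Real.tendsto_log_atTop.comp tendsto_natCast_atTop_atTop
  have h1 : Tendsto (fun x : ℝ => Real.log x / x) atTop (𝓝 0) :=
    Real.isLittleO_log_id_atTop.tendsto_div_nhds_zero
  have h2 : Tendsto (fun n : ℕ => (1 + (k : ℝ) * (Real.log (Real.log n) / Real.log n))⁻¹)
      atTop (𝓝 (1 + (k : ℝ) * 0)⁻¹) :=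
    (tendsto_const_nhds.add ((h1.comp hL).const_mul _)).inv₀ (by simp)
  simp only [mul_zero, add_zero, inv_one] at h2
  refine h2.congr' ?_
  filter_upwards [hL.eventually_gt_atTop 0] with n hn
  have h3 : Real.log n + (k : ℝ) * Real.log (Real.log n) =
      Real.log n * (1 + (k : ℝ) * (Real.log (Real.log n) / Real.log n)) := by
    field_simp
  rw [h3, div_mul_eq_div_div, div_self hn.ne', one_div]

/-- The first-order asymptotics of the critical radius. -/
theorem ae_tendsto_criticalRadius_div_log {Ω : Type*} [MeasurableSpace Ω] {μ : Measure Ω}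
    [IsProbabilityMeasure μ] {k : ℕ} (hk : 1 ≤ k) {P : ℕ → Ω → Set (EuclideanSpace ℝ (Fin 2))}
    (hP : ∀ n : ℕ, 1 ≤ n → IsPoissonProcess (n : ℝ≥0) (P n) μ)
    (hmono : ∀ᵐ ω ∂μ, ∀ n : ℕ, 1 ≤ n → P n ω ⊆ P (n + 1) ω) :
    ∀ᵐ ω ∂μ, Tendsto
      (fun n : ℕ => Real.pi * (n : ℝ) * criticalRadius k (P n ω) ^ 2 / Real.log n)
      atTop (𝓝 1) := by
  -- Countably many levels, so that one null set serves them all. The `q + 2` in the lower levels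
  -- keeps them strictly between `0` and `1`, also at `q = 0`.
  have hup : ∀ᵐ ω ∂μ, ∀ q : ℕ, ∀ᶠ n : ℕ in atTop, ∃ r : ℝ, 0 < r ∧
      vacancy k (P n ω) r unitSquare = 0 ∧
      Real.pi * n * r ^ 2 ≤ (1 + 1 / ((q : ℝ) + 1)) * Real.log n :=
    ae_all_iff.2 fun q => ae_eventually_exists_vacancy_eq_zero k hP hmono
      (lt_add_of_pos_right 1 (by positivity))
  have hlow : ∀ᵐ ω ∂μ, ∀ q : ℕ, ∀ᶠ n : ℕ in atTop,
      vacancy k (P n ω) (logRadius (1 - 1 / ((q : ℝ) + 2)) n) unitSquare ≠ 0 :=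
    ae_all_iff.2 fun q => ae_eventually_vacancy_ne_zero hk hP
      (sub_pos.2 ((div_lt_one (by positivity)).2 (by linarith [q.cast_nonneg (α := ℝ)])))
      (sub_lt_self 1 (by positivity))
  filter_upwards [hup, hlow] with ω hup hlow
  have hpi := Real.pi_pos
  refine tendsto_order.2 ⟨fun a ha => ?_, fun a ha => ?_⟩
  · obtain ⟨q, hq⟩ := exists_nat_one_div_lt (sub_pos.2 ha)
    -- `hup 0` only supplies some admissible radius, as `le_criticalRadius` requires.
    filter_upwards [hup 0, hlow q, eventually_ge_atTop 2] with n ⟨s, hs0, hs, _⟩ hr h2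
    have hlog : 0 < Real.log n := Real.log_pos (by exact_mod_cast h2)
    have hn0 : (0 : ℝ) < n := by positivity
    have hq2 : 1 / ((q : ℝ) + 2) ≤ 1 / ((q : ℝ) + 1) := by gcongr; norm_num
    have hb0 : 0 ≤ 1 - 1 / ((q : ℝ) + 2) :=
      sub_nonneg.2 ((div_le_one (by positivity)).2 (by linarith [q.cast_nonneg (α := ℝ)]))
    rw [lt_div_iff₀ hlog]
    calc a * Real.log n < (1 - 1 / ((q : ℝ) + 2)) * Real.log n := by gcongr; linarith
      _ = Real.pi * n * logRadius (1 - 1 / ((q : ℝ) + 2)) n ^ 2 := by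
          rw [← mul_logRadius_sq hb0 (by omega)]; ring
      _ ≤ Real.pi * n * criticalRadius k (P n ω) ^ 2 := by
          gcongr
          · exact logRadius_nonneg _ _
          · exact le_criticalRadius hs0 hs hr
  · obtain ⟨q, hq⟩ := exists_nat_one_div_lt (sub_pos.2 ha)
    filter_upwards [hup q, eventually_ge_atTop 2] with n ⟨s, hs0, hs, hle⟩ h2
    have hlog : 0 < Real.log n := Real.log_pos (by exact_mod_cast h2)
    rw [div_lt_iff₀ hlog]
    calc Real.pi * n * criticalRadius k (P n ω) ^ 2 ≤ Real.pi * n * s ^ 2 := by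
          gcongr
          · exact criticalRadius_nonneg _ _
          · exact criticalRadius_le hs0 hs
      _ ≤ (1 + 1 / ((q : ℝ) + 1)) * Real.log n := hle
      _ < a * Real.log n := by gcongr; linarith

end Coverage

theorem theorem5 {Ω : Type*} [MeasurableSpace Ω] (μ : Measure Ω) [IsProbabilityMeasure μ]
    (k : ℕ) (hk : 1 ≤ k)
    (P : ℕ → Ω → Set (EuclideanSpace ℝ (Fin 2)))
    (hP : ∀ n : ℕ, 1 ≤ n → Coverage.IsPoissonProcess (n : ℝ≥0) (P n) μ)
    (hmono : ∀ᵐ ω ∂μ, ∀ n : ℕ, 1 ≤ n → P n ω ⊆ P (n + 1) ω) :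
    ∀ᵐ ω ∂μ, Tendsto
      (fun n : ℕ => Real.pi * (n : ℝ) * Coverage.criticalRadius k (P n ω) ^ 2 /
        (Real.log n + (k : ℝ) * Real.log (Real.log n)))
      atTop (𝓝 1) := by
  filter_upwards [Coverage.ae_tendsto_criticalRadius_div_log hk hP hmono] with ω hω
  have h := hω.mul (Coverage.tendsto_log_div_log_add_log_log k)
  rw [mul_one] at h
  refine h.congr' ?_
  filter_upwards [eventually_ge_atTop 2] with n hn
  have hlog : 0 < Real.log n := Real.log_pos (by exact_mod_cast hn)
  rw [div_mul_div_cancel₀ hlog.ne']
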